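/- Let $p$ be a prime and let $F$ be a field containing a primitive $p$th root of unity $\xi_p$. Fix a separable closure of $F$; all extensions of $F$ below are taken inside it. For a field $k$ let $k^{(2)}$ denote the compositum of all cyclic extensions of $k$ of degree $p$; let ${F^{(2)}}^{(2)}=(F^{(2)})^{(2)}$, and let $F^{(3)}$ be the compositum of all cyclic extensions of $F^{(2)}$ of degree $p$ which are Galois over $F$. Put $V_F=\mathrm{Gal}({F^{(2)}}^{(2)}/F)$ and $W_F=\mathrm{Gal}(F^{(3)}/F)$, and, for a cyclic extension $E/F$ of degree $p$, $T_{E/F}=\mathrm{Gal}(E^{(2)}/F)$; since $E^{(2)}\subset {F^{(2)}}^{(2)}$, each $\sigma\in V_F$ restricts to an element $\sigma_{E/F}\in T_{E/F}$. For a pro-$p$-group $\Gamma$ let $\Phi(\Gamma)$ denote its Frattini subgroup, i.e. the closed subgroup generated by all $p$th powers and all commutators. Then the following are equivalent: 1. There exists $\sigma\in V_F\setminus\Phi(V_F)$ of order $p$. 2. There exists $\sigma\in W_F\setminus\Phi(W_F)$ of order $p$. 3. There exists $\sigma\in V_F\setminus\Phi(V_F)$ such that for each cyclic extension $E/F$ of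 degree $p$ the image $\sigma_{E/F}\in T_{E/F}$ has order at most $p$. 4. $p=2$ and $F$ is formally real. Moreover, if these conditions hold, then for every $\sigma$ as in (1), (2) or (3) the set of elements $a\in F$ whose square roots are fixed by $\sigma$ is (the set of nonnegative elements of) an ordering of $F$. -/

import Mathlib

namespace SmallGalois

open scoped commutatorElement

/-- `K/k` is a cyclic (Galois) extension of degree `p`. -/
structure IsCyclicExt (p : ℕ) (k K : Type*) [Field k] [Field K] [Algebra k K] : Prop where
  isGalois : IsGalois k K
  isCyclic : IsCyclic Gal(K/k)
  finrank_eq : Module.finrank k K = p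

/-- The compositum `k^{(2)}` inside `Ω` of all cyclic extensions of `k` of degree `p`. -/
def maxElem (p : ℕ) (k Ω : Type*) [Field k] [Field Ω] [Algebra k Ω] : IntermediateField k Ω :=
  ⨆ (K : IntermediateField k Ω) (_ : IsCyclicExt p k K), K

/-- The closed subgroup `Γ^p[Γ,Γ]` of a topological group `Γ`; for a pro-`p`-group this is its
Frattini subgroup `Φ(Γ)`. -/
def Phi (p : ℕ) (Γ : Type*) [Group Γ] [TopologicalSpace Γ] [IsTopologicalGroup Γ] : Subgroup Γ :=
  (Subgroup.closure (Set.range fun g : Γ => g ^ p) ⊔ commutator Γ).topologicalClosure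

section Kummer

variable {k Ω : Type*} [Field k] [Field Ω] [Algebra k Ω] [IsGalois k Ω]

/-- The elements of `k^{(2)}` are those fixed by all `p`-th powers and all commutators of the
absolute Galois group. -/
theorem mem_maxElem_iff {p : ℕ} (hp : p.Prime) (x : Ω) :
    x ∈ maxElem p k Ω ↔ ∀ g h : Gal(Ω/k), (g ^ p) x = x ∧ ⁅g, h⁆ x = x := by
  constructor
  · intro hx g h
    have key : ∀ t : Gal(Ω/k), (∀ K : IntermediateField k Ω, IsCyclicExt p k K →
        t ∈ K.fixingSubgroup) → t x = x := by
      intro t ht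
      have : maxElem p k Ω ≤ IntermediateField.fixedField (Subgroup.zpowers t) := by
        refine iSup₂_le fun K hK => ?_
        rw [IntermediateField.le_iff_le, Subgroup.zpowers_le]
        exact ht K hK
      exact this hx ⟨t, Subgroup.mem_zpowers t⟩
    refine ⟨key _ fun K hK => ?_, key _ fun K hK => ?_⟩
    · have := hK.isGalois
      have : FiniteDimensional k K := Module.finite_of_finrank_pos (by
        rw [hK.finrank_eq]; exact hp.pos)
      rw [← IntermediateField.restrictNormalHom_ker, MonoidHom.mem_ker, map_pow]
      have hc : Nat.card Gal(K/k) = p := by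
        rw [IsGalois.card_aut_eq_finrank, hK.finrank_eq]
      rw [← hc]
      exact pow_card_eq_one'
    · have := hK.isGalois
      have := hK.isCyclic
      rw [← IntermediateField.restrictNormalHom_ker, MonoidHom.mem_ker, map_commutatorElement,
        commutatorElement_eq_one_iff_mul_comm]
      have := IsCyclic.isMulCommutative (α := Gal(K/k))
      exact this.is_comm.comm _ _
  · intro hx
    -- `D`: the normal subfield of all elements fixed by `p`-th powers and commutators
    let N : Subgroup Gal(Ω/k) :=
      Subgroup.closure (Set.range fun g : Gal(Ω/k) => g ^ p) ⊔ commutator Gal(Ω/k)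
    have hNpow : ∀ g : Gal(Ω/k), g ^ p ∈ N := fun g =>
      (le_sup_left : _ ≤ N) (Subgroup.subset_closure ⟨g, rfl⟩)
    have hNcomm : ∀ g h : Gal(Ω/k), ⁅g, h⁆ ∈ N := fun g h =>
      (le_sup_right : _ ≤ N) (Subgroup.commutator_mem_commutator (Subgroup.mem_top g)
        (Subgroup.mem_top h))
    let D : IntermediateField k Ω := IntermediateField.fixedField N
    have hxD : x ∈ D := by
      have hle : N ≤ MulAction.stabilizer Gal(Ω/k) x := by
        refine sup_le ?_ ?_
        · rw [Subgroup.closure_le]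
          rintro _ ⟨g, rfl⟩
          exact (hx g 1).1
        · rw [commutator_def, Subgroup.commutator_le]
          intro g _ h _
          exact (hx g h).2
      rintro ⟨t, ht⟩
      exact hle ht
    have hDn : Normal k D := by
      rw [IntermediateField.normal_iff_forall_map_le']
      rintro s _ ⟨y, hy, rfl⟩ ⟨t, ht⟩
      have h1 : s⁻¹ * t * s ∈ N := by
        have h2 := N.mul_mem ht (hNcomm t⁻¹ s⁻¹)
        have h3 : t * ⁅t⁻¹, s⁻¹⁆ = s⁻¹ * t * s := by
          rw [commutatorElement_def]; group
        rwa [h3] at h2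
      have h4 : (s⁻¹ * t * s) y = y := hy ⟨_, h1⟩
      have h5 : s ((s⁻¹ * t * s) y) = t (s y) := by
        rw [← AlgEquiv.mul_apply, ← AlgEquiv.mul_apply]
        congr 1
        group
      change t (s y) = s y
      rw [← h5, h4]
    let M : IntermediateField k Ω := IntermediateField.adjoin k {x}
    have : FiniteDimensional k M :=
      IntermediateField.adjoin.finiteDimensional (Algebra.IsIntegral.isIntegral x)
    let L : IntermediateField k Ω := IntermediateField.normalClosure k M Ω
    have hLD : L ≤ D := by
      rw [IntermediateField.normalClosure_le_iff_of_normal]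
      exact IntermediateField.adjoin_simple_le_iff.2 hxD
    have hxL : x ∈ L :=
      IntermediateField.le_normalClosure M (IntermediateField.mem_adjoin_simple_self k x)
    have : FiniteDimensional k L := normalClosure.is_finiteDimensional k M Ω
    have : IsGalois k L := IsGalois.normalClosure k M Ω
    let r : Gal(Ω/k) →* Gal(L/k) := AlgEquiv.restrictNormalHom L
    have hr : Function.Surjective r := AlgEquiv.restrictNormalHom_surjective Ω
    have hrN : ∀ t ∈ N, r t = 1 := by
      intro t ht
      rw [← MonoidHom.mem_ker, IntermediateField.restrictNormalHom_ker,
        IntermediateField.mem_fixingSubgroup_iff]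
      intro y hy
      exact hLD hy ⟨t, ht⟩
    let _ : CommGroup Gal(L/k) :=
      { (inferInstance : Group Gal(L/k)) with
        mul_comm := fun a b => by
          obtain ⟨g, rfl⟩ := hr a
          obtain ⟨h, rfl⟩ := hr b
          rw [← commutatorElement_eq_one_iff_mul_comm, ← map_commutatorElement]
          exact hrN _ (hNcomm g h) }
    rw [← InfiniteGalois.fixedField_fixingSubgroup (maxElem p k Ω)]
    rintro ⟨τ, hτ⟩
    change τ x = x
    by_contra hne
    have hrτ : r τ ≠ 1 := by
      intro h
      rw [← MonoidHom.mem_ker, IntermediateField.restrictNormalHom_ker,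
        IntermediateField.mem_fixingSubgroup_iff] at h
      exact hne (h x hxL)
    -- a character of order `p` which is nontrivial at `τ`
    have hexp : NeZero (Monoid.exponent Gal(L/k)) := ⟨Monoid.exponent_ne_zero_of_finite⟩
    have hroots : HasEnoughRootsOfUnity ℂ (Monoid.exponent Gal(L/k)) := inferInstance
    obtain ⟨φ, hφ⟩ :=
      CommGroup.exists_apply_ne_one_of_hasEnoughRootsOfUnity Gal(L/k) ℂ hrτ
    let ψ : Gal(Ω/k) →* ℂˣ := φ.comp r
    have hopen : IsOpen (ψ.ker : Set Gal(Ω/k)) := by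
      refine Subgroup.isOpen_mono (H₁ := L.fixingSubgroup) ?_ L.fixingSubgroup_isOpen
      rw [← IntermediateField.restrictNormalHom_ker]
      intro t ht
      rw [MonoidHom.mem_ker] at ht ⊢
      change φ (r t) = 1
      rw [show r t = 1 from ht, map_one]
    let K : IntermediateField k Ω := IntermediateField.fixedField ψ.ker
    have hKfix : K.fixingSubgroup = ψ.ker :=
      InfiniteGalois.fixingSubgroup_fixedField
        ⟨ψ.ker, Subgroup.isClosed_of_isOpen _ hopen⟩
    have hKgal : IsGalois k K := by
      rw [← InfiniteGalois.normal_iff_isGalois, hKfix]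
      infer_instance
    have hKfin : FiniteDimensional k K := by
      rw [← InfiniteGalois.isOpen_iff_finite, hKfix]
      exact hopen
    let e : Gal(K/k) ≃* ψ.range :=
      (QuotientGroup.quotientKerEquivOfSurjective _
        (AlgEquiv.restrictNormalHom_surjective (F := k) (K₁ := K) Ω)).symm.trans
      ((QuotientGroup.quotientMulEquivOfEq (by
        rw [IntermediateField.restrictNormalHom_ker, hKfix])).trans
      (QuotientGroup.quotientKerEquivRange ψ))
    have : Finite ψ.range := Finite.of_equiv _ e.toEquiv
    have hcyc : IsCyclic ψ.range := inferInstance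
    have hcard : Nat.card ψ.range = p := by
      have hdvd : Monoid.exponent ψ.range ∣ p := by
        rw [Monoid.exponent_dvd_iff_forall_pow_eq_one]
        rintro ⟨_, t, rfl⟩
        apply Subtype.ext
        change (φ (r t)) ^ p = 1
        rw [← map_pow, ← map_pow, hrN _ (hNpow t), map_one]
      rw [IsCyclic.exponent_eq_card] at hdvd
      refine ((Nat.dvd_prime hp).1 hdvd).resolve_left fun h1 => hφ ?_
      have := (Nat.card_eq_one_iff_unique.1 h1).1
      exact congrArg Subtype.val (Subsingleton.elim (⟨ψ τ, τ, rfl⟩ : ψ.range) 1)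
    have hKc : IsCyclicExt p k K := ⟨hKgal, by
      exact isCyclic_of_surjective e.symm e.symm.surjective, by
      rw [← IsGalois.card_aut_eq_finrank, Nat.card_congr e.toEquiv, hcard]⟩
    have hKle : K ≤ maxElem p k Ω := le_iSup₂_of_le K hKc le_rfl
    have : τ ∈ ψ.ker := hKfix ▸ IntermediateField.fixingSubgroup_le hKle hτ
    exact hφ this

/-- The Galois group of `Ω` over `k^{(2)}` is the closed subgroup `G_k^p[G_k,G_k]` of `G_k`. -/
theorem fixingSubgroup_maxElem {p : ℕ} (hp : p.Prime) :
    (maxElem p k Ω).fixingSubgroup = Phi p Gal(Ω/k) := by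
  have h : maxElem p k Ω = IntermediateField.fixedField (Phi p Gal(Ω/k)) := by
    ext x
    rw [mem_maxElem_iff hp]
    constructor
    · intro hx
      let M : IntermediateField k Ω := IntermediateField.adjoin k {x}
      have hle : Phi p Gal(Ω/k) ≤ M.fixingSubgroup := by
        refine Subgroup.topologicalClosure_minimal _ ?_
          (InfiniteGalois.fixingSubgroup_isClosed M)
        have hmem : ∀ t : Gal(Ω/k), t x = x → t ∈ M.fixingSubgroup := by
          intro t ht
          rw [← Subgroup.zpowers_le, ← IntermediateField.le_iff_le,
            IntermediateField.adjoin_simple_le_iff]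
          have : Subgroup.zpowers t ≤ MulAction.stabilizer Gal(Ω/k) x := by
            rw [Subgroup.zpowers_le]; exact ht
          rintro ⟨s, hs⟩
          exact this hs
        refine sup_le ?_ ?_
        · rw [Subgroup.closure_le]
          rintro _ ⟨g, rfl⟩
          exact hmem _ (hx g 1).1
        · rw [commutator_def, Subgroup.commutator_le]
          intro g _ h _
          exact hmem _ (hx g h).2
      rintro ⟨t, ht⟩
      exact (IntermediateField.mem_fixingSubgroup_iff M t).1 (hle ht) x
        (IntermediateField.mem_adjoin_simple_self k x)
    · intro hx g h
      refine ⟨hx ⟨g ^ p, ?_⟩, hx ⟨⁅g, h⁆, ?_⟩⟩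
      · exact Subgroup.le_topologicalClosure _
          ((le_sup_left : _ ≤ _ ⊔ commutator Gal(Ω/k)) (Subgroup.subset_closure ⟨g, rfl⟩))
      · exact Subgroup.le_topologicalClosure _
          ((le_sup_right : commutator Gal(Ω/k) ≤ _)
            (Subgroup.commutator_mem_commutator (Subgroup.mem_top g) (Subgroup.mem_top h)))
  rw [h]
  exact InfiniteGalois.fixingSubgroup_fixedField
    ⟨Phi p Gal(Ω/k), Subgroup.isClosed_topologicalClosure _⟩

end Kummer

section Fields

variable (p : ℕ) (F Ω : Type*) [Field F] [Field Ω] [Algebra F Ω]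

/-- For `F ⊆ E ⊆ Ω`, the field `E^{(2)}`, regarded as an extension of `F`. -/
def second {F Ω : Type*} [Field F] [Field Ω] [Algebra F Ω] (E : IntermediateField F Ω) :
    IntermediateField F Ω :=
  (maxElem p E Ω).restrictScalars F

/-- `(F^{(2)})^{(2)}`, regarded as an extension of `F`. -/
def secondSecond : IntermediateField F Ω :=
  second p (maxElem p F Ω)

/-- `F^{(3)}`: the compositum of all cyclic extensions of `F^{(2)}` of degree `p` which are Galois
over `F`, regarded as an extension of `F`. -/
def third : IntermediateField F Ω :=
  (⨆ (K : IntermediateField (maxElem p F Ω) Ω)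
    (_ : IsCyclicExt p (maxElem p F Ω) K ∧ IsGalois F (K.restrictScalars F)),
      K).restrictScalars F

/-- `V_F = Gal((F^{(2)})^{(2)}/F)`. -/
abbrev VGroup : Type _ := Gal(secondSecond p F Ω/F)

/-- `W_F = Gal(F^{(3)}/F)`. -/
abbrev WGroup : Type _ := Gal(third p F Ω/F)

/-- `T_{E/F} = Gal(E^{(2)}/F)`. By `fixingSubgroup_second` below, this is the quotient of `G_F` by
its closed subgroup `G_E^p[G_E,G_E]`. -/
abbrev TGroup {F Ω : Type*} [Field F] [Field Ω] [Algebra F Ω] (E : IntermediateField F Ω) :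
    Type _ := Gal(second p E/F)

end Fields

section Restriction

variable {F Ω : Type*} [Field F] [Field Ω] [Algebra F Ω]

/-- Restriction of automorphisms from `L` to a subfield `K` that is normal over `F`. -/
noncomputable def restrictHom {K L : IntermediateField F Ω} (h : K ≤ L) [Normal F K] :
    Gal(L/F) →* Gal(K/F) :=
  letI : Algebra K L := (IntermediateField.inclusion h).toRingHom.toAlgebra
  haveI : IsScalarTower F K L := IsScalarTower.of_algHom (IntermediateField.inclusion h)
  AlgEquiv.restrictNormalHom K

theorem coe_restrictHom {K L : IntermediateField F Ω} (h : K ≤ L) [Normal F K]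
    (σ : Gal(L/F)) (x : K) :
    (restrictHom h σ x : Ω) = (σ (IntermediateField.inclusion h x) : Ω) := by
  let _ : Algebra K L := (IntermediateField.inclusion h).toRingHom.toAlgebra
  have : IsScalarTower F K L := IsScalarTower.of_algHom (IntermediateField.inclusion h)
  exact congrArg Subtype.val (AlgEquiv.restrictNormal_commutes σ K x)

variable [IsGalois F Ω]

/-- The Galois group of `Ω` over `E^{(2)}` is the closed subgroup `G_E^p[G_E,G_E]` of `G_F`. -/
theorem fixingSubgroup_second {p : ℕ} (hp : p.Prime) (E : IntermediateField F Ω) :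
    (second p E).fixingSubgroup = (Phi p Gal(Ω/E)).map (AlgEquiv.restrictScalarsHom F) := by
  rw [← fixingSubgroup_maxElem hp]
  ext t
  rw [IntermediateField.mem_fixingSubgroup_iff, Subgroup.mem_map]
  constructor
  · intro ht
    have htE : ∀ c : E, t c = c := fun c =>
      ht c ((maxElem p E Ω).algebraMap_mem c)
    exact ⟨AlgEquiv.ofRingEquiv (f := t.toRingEquiv) htE,
      (IntermediateField.mem_fixingSubgroup_iff _ _).2 ht, rfl⟩
  · rintro ⟨u, hu, rfl⟩
    exact (IntermediateField.mem_fixingSubgroup_iff _ _).1 hu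

theorem normal_second {p : ℕ} (hp : p.Prime) (E : IntermediateField F Ω) [Normal F E] :
    Normal F (second p E) := by
  rw [IntermediateField.normal_iff_forall_map_le']
  rintro s _ ⟨y, hy, rfl⟩
  have hy' := (mem_maxElem_iff hp y).1 hy
  refine (mem_maxElem_iff hp _).2 fun g h => ?_
  have hmap := IntermediateField.normal_iff_forall_map_le'.1 (inferInstance : Normal F E)
  -- conjugation by `s` preserves the Galois group of `Ω/E`
  have conj : ∀ g : Gal(Ω/E), ∃ g' : Gal(Ω/E), ∀ z, s (g' z) = g (s z) := by
    intro g
    refine ⟨AlgEquiv.ofRingEquiv (f := (s.toRingEquiv.trans g.toRingEquiv).trans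
      s.symm.toRingEquiv) ?_, fun z => ?_⟩
    · intro c
      have hc : s c ∈ E := hmap s ⟨c, c.2, rfl⟩
      have : g (s c) = s c := g.commutes ⟨s c, hc⟩
      change s.symm (g (s c)) = c
      rw [this, AlgEquiv.symm_apply_apply]
    · exact s.apply_symm_apply _
  obtain ⟨g', hg⟩ := conj g
  obtain ⟨h', hh⟩ := conj h
  have hinv : ∀ (a a' : Gal(Ω/E)), (∀ z, s (a' z) = a (s z)) →
      ∀ z, s (a'⁻¹ z) = a⁻¹ (s z) := by
    intro a a' ha z
    apply a.injective
    rw [← ha, ← AlgEquiv.mul_apply, ← AlgEquiv.mul_apply, mul_inv_cancel, mul_inv_cancel]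
    rfl
  have hpow : ∀ (n : ℕ) z, s ((g' ^ n) z) = (g ^ n) (s z) := by
    intro n
    induction n with
    | zero => intro z; rfl
    | succ n ih =>
      intro z
      rw [pow_succ, pow_succ, AlgEquiv.mul_apply, AlgEquiv.mul_apply, ih, hg]
  constructor
  · change (g ^ p) (s y) = s y
    rw [← hpow, (hy' g' h').1]
  · change ⁅g, h⁆ (s y) = s y
    have : s (⁅g', h'⁆ y) = ⁅g, h⁆ (s y) := by
      simp only [commutatorElement_def, AlgEquiv.mul_apply]
      rw [hg, hh, hinv g g' hg, hinv h h' hh]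
    rw [← this, (hy' g' h').2]

theorem second_le_secondSecond {p : ℕ} (hp : p.Prime) {E : IntermediateField F Ω}
    (hE : IsCyclicExt p F E) : second p E ≤ secondSecond p F Ω := by
  have hle : E ≤ maxElem p F Ω := le_iSup₂_of_le E hE le_rfl
  intro x hx
  have hx' := (mem_maxElem_iff hp x).1 hx
  refine (mem_maxElem_iff hp x).2 fun g h => ?_
  let lower : Gal(Ω/maxElem p F Ω) →* Gal(Ω/E) :=
    { toFun := fun g => AlgEquiv.ofRingEquiv (f := g.toRingEquiv)
        fun c => g.commutes ⟨c, hle c.2⟩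
      map_one' := rfl
      map_mul' := fun _ _ => rfl }
  have hlow : ∀ (g : Gal(Ω/maxElem p F Ω)) (z : Ω), lower g z = g z := fun _ _ => rfl
  obtain ⟨h1, h2⟩ := hx' (lower g) (lower h)
  rw [← map_pow, hlow] at h1
  rw [← map_commutatorElement, hlow] at h2
  exact ⟨h1, h2⟩

/-- The image `σ_{E/F}` in `T_{E/F}` of an element `σ` of `V_F`: the restriction of `σ` to
`E^{(2)} ⊆ (F^{(2)})^{(2)}`. -/
noncomputable def toT {p : ℕ} (hp : p.Prime) (E : IntermediateField F Ω)
    (hE : IsCyclicExt p F E) : VGroup p F Ω →* TGroup p E :=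
  haveI : IsGalois F E := hE.isGalois
  haveI : Normal F (second p E) := normal_second hp E
  restrictHom (second_le_secondSecond hp hE)

end Restriction

section Orderings

/-- The elements of `F` whose square roots in `L` exist and are fixed by `σ`. (If one square root
is fixed, then so is the other one.) -/
def fixedRoots {F L : Type*} [Field F] [Field L] [Algebra F L] (σ : Gal(L/F)) : Set F :=
  {a | ∃ x : L, x ^ 2 = algebraMap F L a ∧ σ x = x}

/-- `S` is (the set of nonnegative elements of) an ordering of the field `F`. -/
def IsOrderingSet {F : Type*} [Field F] (S : Set F) : Prop :=
  ∃ P : RingPreordering F, P.IsOrdering ∧ (P : Set F) = S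

end Orderings

end SmallGalois

/-! By Kummer theory, an element σ outside the Frattini subgroup moves some θ with θ^p in F. If σ^p
fixes a p-th root u of θ, put ω = σu/u. Then ω^p = ζ := σθ/θ is a root of unity other than 1, σω =
ηω with η^p = 1, and comparing σ^p u with u gives ζ η^(p choose 2) = 1. For odd p this forces ζ = 1,
so p = 2, ω² = -1 and σω = -ω (`eq_two_and_apply_eq_neg`).

Let P be the set of a in F whose square roots σ fixes. It is multiplicative, contains the squares
but not -1, and P ∪ -P = F because σω = -ω. Additivity reduces to 1 + c ∈ P for c = s² in P. With θ
= ωs and u² = 1 + θ, the norm u·σu squares to (1 + θ)(1 - θ) = 1 + c, and it is fixed by σ because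
σ²u = u (`isOrderingSet_fixedRoots`). Only p-th roots of θ and of 1 + θ are used, and these lie both
in F^(3) and in F(θ)^(2), so (2) and (3) suffice as hypotheses.

Conversely, let F be formally real and let L = (F^(2))^(2), whose group over F has exponent dividing
p² = 4. The Artin–Schreier argument works inside L: for a maximal semireal subfield R, one gets L =
R(i), and the automorphism i ↦ -i over R is the required involution (`exists_involution`). Its
restriction to F^(3) serves for W_F. -/

namespace SmallGalois

open IntermediateField Polynomial
open scoped commutatorElement

/-! ### Kummer theory and the Frattini subgroup -/

section Kummer

variable {k Ω : Type*} [Field k] [Field Ω] [Algebra k Ω] {p : ℕ} {ξ : k}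

theorem exists_root_of_unity_mul (hp : p.Prime) (hξ : IsPrimitiveRoot ξ p) {x y : Ω}
    (h : y ^ p = x ^ p) : ∃ ζ : k, ζ ^ p = 1 ∧ y = algebraMap k Ω ζ * x := by
  have := NeZero.mk hp.ne_zero
  rcases eq_or_ne x 0 with rfl | hx
  · rw [zero_pow hp.ne_zero] at h
    exact ⟨1, one_pow p, by rw [eq_zero_of_pow_eq_zero h, mul_zero]⟩
  · have h1 : (y / x) ^ p = 1 := by rw [div_pow, h, div_self (pow_ne_zero p hx)]
    obtain ⟨i, -, hi⟩ :=
      (hξ.map_of_injective (algebraMap k Ω).injective).eq_pow_of_pow_eq_one h1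
    refine ⟨ξ ^ i, by rw [← pow_mul, mul_comm, pow_mul, hξ.pow_eq_one, one_pow], ?_⟩
    rw [map_pow, hi, div_mul_cancel₀ y hx]

theorem exists_apply_eq_mul (hp : p.Prime) (hξ : IsPrimitiveRoot ξ p) (g : Gal(Ω/k)) {u : Ω}
    {a : k} (hu : u ^ p = algebraMap k Ω a) :
    ∃ ζ : k, ζ ^ p = 1 ∧ g u = algebraMap k Ω ζ * u :=
  exists_root_of_unity_mul hp hξ (by rw [← map_pow, hu, AlgEquiv.commutes])

theorem pow_apply_of_apply_eq_mul {g : Gal(Ω/k)} {u : Ω} {ζ : k}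
    (h : g u = algebraMap k Ω ζ * u) (n : ℕ) : (g ^ n) u = algebraMap k Ω ζ ^ n * u := by
  induction n with
  | zero => simp
  | succ n ih =>
    rw [pow_succ, AlgEquiv.mul_apply, h, map_mul, AlgEquiv.commutes, ih]
    ring

/-- Kummer generators lie in `k^{(2)}`. -/
theorem mem_maxElem_of_pow_eq [IsGalois k Ω] (hp : p.Prime) (hξ : IsPrimitiveRoot ξ p) {u : Ω}
    {a : k} (hu : u ^ p = algebraMap k Ω a) : u ∈ maxElem p k Ω := by
  refine (mem_maxElem_iff hp u).2 fun g h => ⟨?_, ?_⟩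
  · obtain ⟨ζ, hζ, hg⟩ := exists_apply_eq_mul hp hξ g hu
    rw [pow_apply_of_apply_eq_mul hg, ← map_pow, hζ, map_one, one_mul]
  · have hcomm : ∀ g h : Gal(Ω/k), g (h u) = h (g u) := by
      intro g h
      obtain ⟨ζ, -, hg⟩ := exists_apply_eq_mul hp hξ g hu
      obtain ⟨η, -, hh⟩ := exists_apply_eq_mul hp hξ h hu
      simp only [hg, hh, map_mul, AlgEquiv.commutes]
      ring
    have h1 : ∀ (g : Gal(Ω/k)) (x : Ω), g (g⁻¹ x) = x := fun g x => by
      rw [← AlgEquiv.mul_apply, mul_inv_cancel, AlgEquiv.one_apply]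
    rw [commutatorElement_def]
    simp only [AlgEquiv.mul_apply]
    rw [hcomm g⁻¹ h⁻¹, h1, h1]

theorem isCyclicExt_adjoin_simple (hp : p.Prime) (hξ : IsPrimitiveRoot ξ p) {u : Ω} {a : k}
    (hu : u ^ p = algebraMap k Ω a) (hk : u ∉ (algebraMap k Ω).range) :
    IsCyclicExt p k k⟮u⟯ := by
  have hirr : Irreducible (X ^ p - C a) := by
    -- If a = b^p in k, then u would be a root of unity of k times b, hence in k.
    refine X_pow_sub_C_irreducible_of_prime hp fun b hb => hk ?_
    obtain ⟨ζ, -, h⟩ := exists_root_of_unity_mul (Ω := Ω) hp hξ (x := algebraMap k Ω b) (y := u)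
      (by rw [hu, ← hb, map_pow])
    exact ⟨ζ * b, by rw [h, map_mul]⟩
  have hmin : minpoly k u = X ^ p - C a :=
    (minpoly.eq_of_irreducible_of_monic hirr (by simp [hu])
      (monic_X_pow_sub_C a hp.ne_zero)).symm
  have hint : IsIntegral k u := ⟨X ^ p - C a, monic_X_pow_sub_C a hp.ne_zero, by simp [hu]⟩
  have : FiniteDimensional k k⟮u⟯ := adjoin.finiteDimensional hint
  have hfin : Module.finrank k k⟮u⟯ = p := by
    rw [adjoin.finrank hint, hmin, natDegree_X_pow_sub_C]
  have hgen : ∃ α : k⟮u⟯, α ^ Module.finrank k k⟮u⟯ ∈ Set.range (algebraMap k k⟮u⟯) ∧ k⟮α⟯ = ⊤ :=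
    ⟨AdjoinSimple.gen k u, ⟨a, Subtype.ext (by rw [hfin]; simpa using hu.symm)⟩, by
      apply lift_injective
      rw [lift_adjoin_simple, lift_top, AdjoinSimple.coe_gen]⟩
  have key : IsGalois k k⟮u⟯ ∧ IsCyclic Gal(k⟮u⟯/k) := ((isCyclic_tfae k k⟮u⟯ (by
    rw [hfin]
    exact ⟨ξ, (mem_primitiveRoots hp.pos).2 hξ⟩)).out 0 2).2 hgen
  exact ⟨key.1, key.2, hfin⟩

/-- The Frattini subgroup fixes exactly k^(2), which is generated by Kummer radicals; an element
fixing all of these lies in it. -/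
theorem exists_pow_eq_of_notMem_Phi [IsGalois k Ω] (hp : p.Prime) (hξ : IsPrimitiveRoot ξ p)
    {σ : Gal(Ω/k)} (hσ : σ ∉ Phi p Gal(Ω/k)) :
    ∃ (a : k) (θ : Ω), θ ^ p = algebraMap k Ω a ∧ σ θ ≠ θ := by
  by_contra! hcon
  apply hσ
  rw [← fixingSubgroup_maxElem hp, ← Subgroup.zpowers_le, ← le_iff_le]
  refine iSup₂_le fun K hK => ?_
  have := hK.isGalois
  have := hK.isCyclic
  have : FiniteDimensional k K := Module.finite_of_finrank_pos (by
    rw [hK.finrank_eq]; exact hp.pos)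
  obtain ⟨θ, ⟨a, ha⟩, hθ⟩ := exists_root_adjoin_eq_top_of_isCyclic k K (by
    rw [hK.finrank_eq]
    exact ⟨ξ, (mem_primitiveRoots hp.pos).2 hξ⟩)
  have hK' : K = k⟮(θ : Ω)⟯ := by
    rw [← lift_adjoin_simple, hθ, lift_top]
  rw [hK', adjoin_simple_le_iff]
  rw [hK.finrank_eq] at ha
  have h1 : σ (θ : Ω) = θ := hcon a θ (by
    have := congrArg Subtype.val ha
    simpa using this.symm)
  have h2 : Subgroup.zpowers σ ≤ MulAction.stabilizer Gal(Ω/k) (θ : Ω) := by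
    rw [Subgroup.zpowers_le]; exact h1
  rintro ⟨t, ht⟩
  exact h2 ht

theorem notMem_Phi_of_apply_ne [IsGalois k Ω] (hp : p.Prime) (hξ : IsPrimitiveRoot ξ p)
    {σ : Gal(Ω/k)} {a : k} {θ : Ω} (hθ : θ ^ p = algebraMap k Ω a) (h : σ θ ≠ θ) :
    σ ∉ Phi p Gal(Ω/k) := by
  rw [← fixingSubgroup_maxElem hp, IntermediateField.mem_fixingSubgroup_iff]
  exact fun hσ => h (hσ θ (mem_maxElem_of_pow_eq hp hξ hθ))

end Kummer

/-! ### From an automorphism to an ordering -/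

section Core

variable {F L : Type*} [Field F] [Field L] [Algebra F L]

/-- If `σ ^ p` fixes a `p`-th root of a Kummer generator moved by `σ`, then `p = 2` and `σ` moves
a square root of `-1`. -/
theorem eq_two_and_apply_eq_neg {p : ℕ} {ξ : F} (hp : p.Prime) (hξ : IsPrimitiveRoot ξ p)
    {σ : Gal(L/F)} {a : F} {θ u : L} (hθ : θ ^ p = algebraMap F L a) (hσ : σ θ ≠ θ)
    (hu : u ^ p = θ) (hσu : (σ ^ p) u = u) : p = 2 ∧ ∃ ω : L, ω ^ 2 = -1 ∧ σ ω = -ω := by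
  have hθ0 : θ ≠ 0 := by rintro rfl; simp at hσ
  have hu0 : u ≠ 0 := by rintro rfl; exact hθ0 (by rw [← hu, zero_pow hp.ne_zero])
  obtain ⟨ζ, hζ, hσθ⟩ := exists_apply_eq_mul hp hξ σ hθ
  have hζ1 : ζ ≠ 1 := by rintro rfl; exact hσ (by rw [hσθ, map_one, one_mul])
  set ω : L := σ u / u with hω
  have hσu' : σ u = ω * u := by rw [hω, div_mul_cancel₀ _ hu0]
  have hωp : ω ^ p = algebraMap F L ζ := by
    rw [hω, div_pow, ← map_pow, hu, hσθ, mul_div_cancel_right₀ _ hθ0]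
  obtain ⟨η, hη, hση⟩ := exists_apply_eq_mul hp hξ σ hωp
  -- Applying σ to ω^n contributes η^n, so the exponents of η add up to 0 + 1 + ... + (n - 1).
  have key : ∀ n : ℕ, (σ ^ n) u = ω ^ n * algebraMap F L η ^ (n.choose 2) * u := by
    intro n
    induction n with
    | zero => simp
    | succ n ih =>
      rw [pow_succ', AlgEquiv.mul_apply, ih, map_mul, map_mul, map_pow, map_pow,
        AlgEquiv.commutes, hσu', hση, Nat.choose_succ_succ' n 1, Nat.choose_one_right]
      ring
  have h1 : ζ * η ^ (p.choose 2) = 1 := by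
    apply (algebraMap F L).injective
    apply mul_right_cancel₀ hu0
    rw [map_one, one_mul, map_mul, map_pow, ← hωp, ← key, hσu]
  rcases hp.eq_two_or_odd' with rfl | hodd
  · have hζ2 : ζ = -1 := (sq_eq_one_iff.1 hζ).resolve_left hζ1
    rw [Nat.choose_self, pow_one, hζ2] at h1
    refine ⟨rfl, ω, by rw [hωp, hζ2, map_neg, map_one], ?_⟩
    rw [hση, show η = -1 by linear_combination -h1, map_neg, map_one, neg_one_mul]
  -- For odd p, p divides p choose 2, so the η factor disappears and ζ = 1.
  · exfalso
    have h2 : p ∣ p.choose 2 := hp.dvd_choose_self two_ne_zero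
      (lt_of_le_of_ne hp.two_le (by rintro rfl; exact absurd hodd (by decide)))
    obtain ⟨m, hm⟩ := h2
    rw [hm, pow_mul, hη, one_pow, mul_one] at h1
    exact hζ1 h1

/-- The elements of `F` whose square roots are fixed by `σ` form an ordering, provided that `σ` moves a
square root of `-1` and `σ ^ 2` fixes a square root of `1 + θ` for each `θ` moved by `σ` with
`θ ^ 2` in the base field. -/
theorem isOrderingSet_fixedRoots (σ : Gal(L/F)) (h2 : (2 : F) ≠ 0)
    (hroot : ∀ a : F, ∃ x : L, x ^ 2 = algebraMap F L a) {ω : L} (hω : ω ^ 2 = -1)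
    (hσω : σ ω = -ω)
    (hD : ∀ (a : F) (θ : L), θ ^ 2 = algebraMap F L a → σ θ ≠ θ →
      ∃ u : L, u ^ 2 = 1 + θ ∧ (σ ^ 2) u = u) :
    IsOrderingSet (fixedRoots σ) := by
  have h2L : (2 : L) ≠ 0 := by
    rw [← map_ofNat (algebraMap F L) 2]
    exact (_root_.map_ne_zero _).2 h2
  have hω0 : ω ≠ 0 := by rintro rfl; simp at hω
  have hsq : ∀ x : F, x * x ∈ fixedRoots σ := fun x =>
    ⟨algebraMap F L x, by rw [map_mul, sq], σ.commutes x⟩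
  have hmul : ∀ {x y : F}, x ∈ fixedRoots σ → y ∈ fixedRoots σ → x * y ∈ fixedRoots σ := by
    rintro x y ⟨s, hs, hs'⟩ ⟨t, ht, ht'⟩
    exact ⟨s * t, by rw [mul_pow, hs, ht, map_mul], by rw [map_mul, hs', ht']⟩
  have hsign : ∀ {a : F} {x : L}, x ^ 2 = algebraMap F L a → σ x = x ∨ σ x = -x := by
    intro a x hx
    rw [← sq_eq_sq_iff_eq_or_eq_neg, ← map_pow, hx, AlgEquiv.commutes]
  have hor : ∀ a : F, a ∈ fixedRoots σ ∨ -a ∈ fixedRoots σ := by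
    intro a
    obtain ⟨x, hx⟩ := hroot a
    rcases hsign hx with h | h
    · exact Or.inl ⟨x, hx, h⟩
    · exact Or.inr ⟨ω * x, by rw [mul_pow, hω, hx, map_neg]; ring, by
        rw [map_mul, hσω, h]; ring⟩
  have hneg : (-1 : F) ∉ fixedRoots σ := by
    rintro ⟨x, hx, hσx⟩
    have h1 : ω ^ 2 = x ^ 2 := by rw [hω, hx, map_neg, map_one]
    have h3 : σ ω = ω := by
      rcases sq_eq_sq_iff_eq_or_eq_neg.1 h1 with h | h <;> simp [h, hσx]
    have h4 : 2 * ω = 0 := by linear_combination hσω - h3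
    exact (mul_ne_zero h2L hω0) h4
  have hone : ∀ {c : F}, c ∈ fixedRoots σ → 1 + c ∈ fixedRoots σ := by
    rintro c ⟨s, hs, hs'⟩
    rcases eq_or_ne s 0 with rfl | hs0
    · have : c = 0 := by simpa using hs.symm
      simpa [this] using hsq 1
    · have hθ : (ω * s) ^ 2 = algebraMap F L (-c) := by rw [mul_pow, hω, hs, map_neg]; ring
      have hσθ : σ (ω * s) = -(ω * s) := by rw [map_mul, hσω, hs']; ring
      obtain ⟨u, hu, hσu⟩ := hD (-c) (ω * s) hθ (by
        intro h
        have h4 : 2 * (ω * s) = 0 := by linear_combination hσθ - h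
        exact (mul_ne_zero h2L (mul_ne_zero hω0 hs0)) h4)
      rw [sq, AlgEquiv.mul_apply] at hσu
      -- The norm of u: σ swaps its factors since σ²u = u, and its square is (1 + θ)(1 - θ) = 1 - θ²
      -- = 1 + c.
      refine ⟨u * σ u, ?_, by rw [map_mul, hσu, mul_comm]⟩
      rw [mul_pow, ← map_pow, hu, map_add, map_one, hσθ, map_add, map_one]
      rw [map_neg] at hθ
      linear_combination -hθ
  have hadd : ∀ {x y : F}, x ∈ fixedRoots σ → y ∈ fixedRoots σ → x + y ∈ fixedRoots σ := by
    rintro x y hx hy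
    rcases eq_or_ne y 0 with rfl | hy0
    · simpa using hx
    · have h1 := hmul (hmul (hone (hmul (hmul hx hy) (hsq y⁻¹))) hy) (hsq 1)
      convert h1 using 1
      field_simp
      ring
  let P : RingPreordering F := RingPreordering.mk' (fixedRoots σ) hadd hmul hsq hneg
  refine ⟨P, RingPreordering.isOrdering_iff.2 fun a b hab => ?_, rfl⟩
  by_contra! hcon
  have ha : -a ∈ P := (hor a).resolve_left hcon.1
  have hb : -b ∈ P := (hor b).resolve_left hcon.2
  have h0 : a * b = 0 := P.eq_zero_of_mem_of_neg_mem (by simpa using mul_mem ha hb) hab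
  rcases mul_eq_zero.1 h0 with rfl | rfl
  · exact hcon.1 (zero_mem P)
  · exact hcon.2 (zero_mem P)

theorem IsOrderingSet.isFormallyReal {S : Set F} (h : IsOrderingSet S) : IsFormallyReal F := by
  obtain ⟨P, -, -⟩ := h
  refine IsFormallyReal.of_eq_zero_of_eq_zero_of_mul_self_add fun {s a} hs h => ?_
  have h1 : a * a = 0 := P.eq_zero_of_mem_of_neg_mem (P.mul_self_mem a) (by
    rw [show -(a * a) = s by linear_combination -h]
    exact P.mem_of_isSumSq hs)
  exact mul_self_eq_zero.1 h1

end Core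

end SmallGalois

namespace SmallGalois

open IntermediateField Polynomial

section Core

variable {F L : Type*} [Field F] [Field L] [Algebra F L]

/-- Stated for an arbitrary L so that it applies both to F^(3) and to (F^(2))^(2); the hypotheses
list exactly the radicals that L must contain and σ^p must fix. -/
theorem eq_two_and_isOrderingSet {p : ℕ} {ξ : F} (hp : p.Prime) (hξ : IsPrimitiveRoot ξ p)
    (σ : Gal(L/F)) (hroot : ∀ a : F, ∃ x : L, x ^ p = algebraMap F L a)
    (hmove : ∃ (a : F) (θ : L), θ ^ p = algebraMap F L a ∧ σ θ ≠ θ)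
    (h0 : ∀ (a : F) (θ : L), θ ^ p = algebraMap F L a → σ θ ≠ θ →
      ∃ u : L, u ^ p = θ ∧ (σ ^ p) u = u)
    (h1 : p = 2 → ∀ (a : F) (θ : L), θ ^ 2 = algebraMap F L a → σ θ ≠ θ →
      ∃ u : L, u ^ 2 = 1 + θ ∧ (σ ^ 2) u = u) :
    p = 2 ∧ IsOrderingSet (fixedRoots σ) := by
  obtain ⟨a, θ, hθ, hσ⟩ := hmove
  obtain ⟨u, hu, hσu⟩ := h0 a θ hθ hσ
  obtain ⟨rfl, ω, hω, hσω⟩ := eq_two_and_apply_eq_neg hp hξ hθ hσ hu hσu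
  have := NeZero.mk hp.ne_zero
  have h2 : (2 : F) ≠ 0 := by exact_mod_cast hξ.neZero'.out
  exact ⟨rfl, isOrderingSet_fixedRoots σ h2 hroot hω hσω (h1 rfl)⟩

end Core

/-! ### Radicals inside F^(3) and E^(2) -/

section Third

variable {F Ω : Type*} [Field F] [Field Ω] [Algebra F Ω]

theorem maxElem_le_third (p : ℕ) : maxElem p F Ω ≤ third p F Ω := fun x hx =>
  IntermediateField.algebraMap_mem (⨆ (K : IntermediateField (maxElem p F Ω) Ω)
    (_ : IsCyclicExt p (maxElem p F Ω) K ∧ IsGalois F (K.restrictScalars F)), K) ⟨x, hx⟩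

theorem third_le_secondSecond (p : ℕ) : third p F Ω ≤ secondSecond p F Ω := by
  intro x hx
  exact (iSup₂_le fun K hK => le_iSup₂_of_le K hK.1 le_rfl :
    (⨆ (K : IntermediateField (maxElem p F Ω) Ω)
    (_ : IsCyclicExt p (maxElem p F Ω) K ∧ IsGalois F (K.restrictScalars F)), K) ≤
      maxElem p (maxElem p F Ω) Ω) hx

section Normal

variable [Normal F Ω]

/-- The preimage of an intermediate field of `Ω/M` under an automorphism of `Ω/F`, where `M/F` is
normal. -/
def comapOfNormal (M : IntermediateField F Ω) [Normal F M] (s : Gal(Ω/F))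
    (K : IntermediateField M Ω) : IntermediateField M Ω where
  carrier := {x | s x ∈ K}
  mul_mem' {a b} ha hb := by
    simp only [Set.mem_ofPred_eq, map_mul] at *
    exact mul_mem ha hb
  add_mem' {a b} ha hb := by
    simp only [Set.mem_ofPred_eq, map_add] at *
    exact add_mem ha hb
  inv_mem' a ha := by
    simp only [Set.mem_ofPred_eq, map_inv₀] at *
    exact inv_mem ha
  algebraMap_mem' c := K.algebraMap_mem ⟨s c,
    normal_iff_forall_map_le'.1 (inferInstance : Normal F M) s ⟨c, c.2, rfl⟩⟩

@[simp]
theorem mem_comapOfNormal {M : IntermediateField F Ω} [Normal F M] {s : Gal(Ω/F)}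
    {K : IntermediateField M Ω} {x : Ω} : x ∈ comapOfNormal M s K ↔ s x ∈ K :=
  Iff.rfl

theorem normal_maxElem (p : ℕ) : Normal F (maxElem p F Ω) := by
  rw [normal_iff_forall_map_le']
  intro s
  rw [map_le_iff_le_comap]
  refine iSup₂_le fun K hK => ?_
  rw [← map_le_iff_le_comap]
  exact (normal_iff_forall_map_le'.1 hK.isGalois.to_normal s).trans (le_iSup₂_of_le K hK le_rfl)

theorem normal_third (p : ℕ) : Normal F (third p F Ω) := by
  have := normal_maxElem (F := F) (Ω := Ω) p
  rw [normal_iff_forall_map_le']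
  rintro s _ ⟨y, hy, rfl⟩
  refine mem_comapOfNormal.1 ((iSup₂_le fun K hK x hx => mem_comapOfNormal.2 ?_ :
    (⨆ (K : IntermediateField (maxElem p F Ω) Ω)
      (_ : IsCyclicExt p (maxElem p F Ω) K ∧ IsGalois F (K.restrictScalars F)), K) ≤
    comapOfNormal (maxElem p F Ω) s (⨆ (K : IntermediateField (maxElem p F Ω) Ω)
      (_ : IsCyclicExt p (maxElem p F Ω) K ∧ IsGalois F (K.restrictScalars F)), K)) hy)
  have h1 : s x ∈ K := normal_iff_forall_map_le'.1 hK.2.to_normal s ⟨x, hx, rfl⟩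
  exact (le_iSup₂_of_le K hK le_rfl : K ≤ ⨆ (K : IntermediateField (maxElem p F Ω) Ω)
      (_ : IsCyclicExt p (maxElem p F Ω) K ∧ IsGalois F (K.restrictScalars F)), K) h1

end Normal

variable [IsGalois F Ω]

theorem isGalois_third (p : ℕ) : IsGalois F (third p F Ω) where
  to_normal := normal_third p

theorem isGalois_secondSecond {p : ℕ} (hp : p.Prime) : IsGalois F (secondSecond p F Ω) where
  to_normal :=
    have := normal_maxElem (F := F) (Ω := Ω) p
    normal_second hp _

/-- If the conjugates of u stay in F^(2)(u), that field is normal over F and so is one of those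
whose compositum is F^(3). -/
theorem mem_third_of_pow_mem {p : ℕ} {ξ : F} (hp : p.Prime) (hξ : IsPrimitiveRoot ξ p) {u : Ω}
    (hu : u ^ p ∈ maxElem p F Ω)
    (hconj : ∀ g : Gal(Ω/F), g u ∈ (maxElem p F Ω)⟮u⟯) : u ∈ third p F Ω := by
  by_cases hu' : u ∈ maxElem p F Ω
  · exact maxElem_le_third p hu'
  have := normal_maxElem (F := F) (Ω := Ω) p
  have hc : IsCyclicExt p (maxElem p F Ω) (maxElem p F Ω)⟮u⟯ :=
    isCyclicExt_adjoin_simple hp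
      (hξ.map_of_injective (algebraMap F (maxElem p F Ω)).injective)
      (a := ⟨u ^ p, hu⟩) rfl (by rintro ⟨c, rfl⟩; exact hu' c.2)
  have hn : Normal F ((maxElem p F Ω)⟮u⟯.restrictScalars F) := by
    rw [normal_iff_forall_map_le']
    rintro s _ ⟨y, hy, rfl⟩
    have : (maxElem p F Ω)⟮u⟯ ≤ comapOfNormal (maxElem p F Ω) s (maxElem p F Ω)⟮u⟯ :=
      adjoin_simple_le_iff.2 (mem_comapOfNormal.2 (hconj s))
    exact mem_comapOfNormal.1 (this hy)
  exact (le_iSup₂_of_le (maxElem p F Ω)⟮u⟯ ⟨hc, ⟨⟩⟩ le_rfl : (maxElem p F Ω)⟮u⟯ ≤ _)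
    (mem_adjoin_simple_self _ u)

theorem root_mem_third {p : ℕ} {ξ : F} (hp : p.Prime) (hξ : IsPrimitiveRoot ξ p)
    (hroots : ∀ y : Ω, ∃ x : Ω, x ^ p = y) {a : F} {θ u : Ω}
    (hθ : θ ^ p = algebraMap F Ω a) (hu : u ^ p = θ) : u ∈ third p F Ω := by
  refine mem_third_of_pow_mem hp hξ (hu ▸ mem_maxElem_of_pow_eq hp hξ hθ) fun g => ?_
  obtain ⟨ζ, -, hζ⟩ := exists_apply_eq_mul hp hξ g hθ
  -- The conjugate g u is u times a p-th root of ζ, up to a p-th root of unity; since ζ ∈ F, that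
  -- root already lies in F^(2).
  obtain ⟨ω, hω⟩ := hroots (algebraMap F Ω ζ)
  obtain ⟨η, -, hη⟩ := exists_root_of_unity_mul (k := F) hp hξ (x := ω * u) (y := g u) (by
    rw [← map_pow, hu, hζ, mul_pow, hω, hu])
  have hωM : ω ∈ maxElem p F Ω := mem_maxElem_of_pow_eq hp hξ hω
  rw [hη]
  refine mul_mem ?_ (mul_mem ?_ (mem_adjoin_simple_self _ u))
  · exact IntermediateField.algebraMap_mem (maxElem p F Ω)⟮u⟯ (algebraMap F (maxElem p F Ω) η)
  · exact IntermediateField.algebraMap_mem (maxElem p F Ω)⟮u⟯ ⟨ω, hωM⟩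

theorem sqrt_one_add_mem_third {ξ : F} (hξ : IsPrimitiveRoot ξ 2)
    (hroots : ∀ y : Ω, ∃ x : Ω, x ^ 2 = y) {a : F} {θ u : Ω}
    (hθ : θ ^ 2 = algebraMap F Ω a) (hu : u ^ 2 = 1 + θ) : u ∈ third 2 F Ω := by
  have hp := Nat.prime_two
  have hθM : θ ∈ maxElem 2 F Ω := mem_maxElem_of_pow_eq hp hξ hθ
  refine mem_third_of_pow_mem hp hξ (hu ▸ add_mem (one_mem _) hθM) fun g => ?_
  have huu := mem_adjoin_simple_self (maxElem 2 F Ω) u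
  rcases eq_or_ne u 0 with rfl | hu0
  · simp
  have hgθ : g θ = θ ∨ g θ = -θ := by
    rw [← sq_eq_sq_iff_eq_or_eq_neg, ← map_pow, hθ, AlgEquiv.commutes]
  have hgu : (g u) ^ 2 = 1 + g θ := by rw [← map_pow, hu, map_add, map_one]
  rcases hgθ with h | h
  · rw [h, ← hu, sq_eq_sq_iff_eq_or_eq_neg] at hgu
    rcases hgu with h | h <;> rw [h]
    · exact huu
    · exact neg_mem huu
  -- Here (g u · u)² = (1 - θ)(1 + θ) = 1 - a lies in F, so g u · u = ±β with β in F^(2).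
  · obtain ⟨β, hβ⟩ := hroots (algebraMap F Ω (1 - a))
    have hβM : β ∈ (maxElem 2 F Ω)⟮u⟯ :=
      IntermediateField.algebraMap_mem (maxElem 2 F Ω)⟮u⟯ ⟨β, mem_maxElem_of_pow_eq hp hξ hβ⟩
    have h2 : (g u * u) ^ 2 = β ^ 2 := by
      rw [mul_pow, hgu, h, hu, hβ, map_sub, map_one, ← hθ]
      ring
    have h3 : g u = (g u * u) * u⁻¹ := by rw [mul_assoc, mul_inv_cancel₀ hu0, mul_one]
    rw [h3]
    refine mul_mem ?_ (inv_mem huu)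
    rcases sq_eq_sq_iff_eq_or_eq_neg.1 h2 with h | h <;> rw [h]
    · exact hβM
    · exact neg_mem hβM

theorem eq_two_and_isOrderingSet_of_third {p : ℕ} {ξ : F} (hp : p.Prime)
    (hξ : IsPrimitiveRoot ξ p) (hroots : ∀ y : Ω, ∃ x : Ω, x ^ p = y) {σ : WGroup p F Ω}
    (hσ : σ ∉ Phi p (WGroup p F Ω)) (hord : orderOf σ = p) :
    p = 2 ∧ IsOrderingSet (fixedRoots σ) := by
  have := isGalois_third (F := F) (Ω := Ω) p
  have hσp : σ ^ p = 1 := orderOf_dvd_iff_pow_eq_one.1 hord.dvd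
  refine eq_two_and_isOrderingSet hp hξ σ (fun a => ?_) (exists_pow_eq_of_notMem_Phi hp hξ hσ)
    (fun a θ hθ _ => ?_) (fun h2 a θ hθ _ => ?_)
  · obtain ⟨x, hx⟩ := hroots (algebraMap F Ω a)
    exact ⟨⟨x, maxElem_le_third p (mem_maxElem_of_pow_eq hp hξ hx)⟩, Subtype.ext hx⟩
  · obtain ⟨u, hu⟩ := hroots θ
    exact ⟨⟨u, root_mem_third hp hξ hroots (congrArg Subtype.val hθ) hu⟩, Subtype.ext hu,
      by rw [hσp, AlgEquiv.one_apply]⟩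
  · subst h2
    obtain ⟨u, hu⟩ := hroots (1 + θ)
    exact ⟨⟨u, sqrt_one_add_mem_third hξ hroots (congrArg Subtype.val hθ) hu⟩, Subtype.ext hu,
      by rw [hσp, AlgEquiv.one_apply]⟩

theorem coe_toT {p : ℕ} (hp : p.Prime) {E : IntermediateField F Ω} (hE : IsCyclicExt p F E)
    (σ : VGroup p F Ω) (x : second p E) :
    (toT hp E hE σ x : Ω) = (σ (inclusion (second_le_secondSecond hp hE) x) : Ω) := by
  have : IsGalois F E := hE.isGalois
  have : Normal F (second p E) := normal_second hp E
  exact coe_restrictHom _ σ x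

theorem eq_two_and_isOrderingSet_of_toT {p : ℕ} {ξ : F} (hp : p.Prime)
    (hξ : IsPrimitiveRoot ξ p) (hroots : ∀ y : Ω, ∃ x : Ω, x ^ p = y) {σ : VGroup p F Ω}
    (hσ : σ ∉ Phi p (VGroup p F Ω))
    (hT : ∀ (E : IntermediateField F Ω) (hE : IsCyclicExt p F E),
      IsOfFinOrder (toT hp E hE σ) ∧ orderOf (toT hp E hE σ) ≤ p) :
    p = 2 ∧ IsOrderingSet (fixedRoots σ) := by
  have := isGalois_secondSecond (F := F) (Ω := Ω) hp
  -- With E = F(θ), every p-th root of an element of E lies in E^(2), where σ^p acts trivially.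
  have key : ∀ (a : F) (θ : secondSecond p F Ω), θ ^ p = algebraMap F _ a → σ θ ≠ θ →
      ∀ y : Ω, y ∈ F⟮(θ : Ω)⟯ → ∃ u : secondSecond p F Ω, (u ^ p : Ω) = y ∧ (σ ^ p) u = u := by
    intro a θ hθ hσθ y hy
    have hE : IsCyclicExt p F F⟮(θ : Ω)⟯ :=
      isCyclicExt_adjoin_simple hp hξ (a := a) (congrArg Subtype.val hθ) (by
        rintro ⟨c, hc⟩
        have : θ = algebraMap F _ c := Subtype.ext hc.symm
        exact hσθ (by rw [this, AlgEquiv.commutes]))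
    obtain ⟨hfin, hle⟩ := hT _ hE
    set n := orderOf (toT hp _ hE σ) with hn
    have hfix : ∀ (m : ℕ), toT hp _ hE σ ^ m = 1 → ∀ (x : Ω) (hx : x ∈ second p F⟮(θ : Ω)⟯),
        (σ ^ m) ⟨x, second_le_secondSecond hp hE hx⟩ =
          ⟨x, second_le_secondSecond hp hE hx⟩ := by
      intro m hm x hx
      apply Subtype.ext
      have h1 := coe_toT hp hE (σ ^ m) ⟨x, hx⟩
      rw [map_pow, hm] at h1
      exact h1.symm
    have hθmem : (θ : Ω) ∈ second p F⟮(θ : Ω)⟯ :=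
      IntermediateField.algebraMap_mem (maxElem p F⟮(θ : Ω)⟯ Ω) (AdjoinSimple.gen F (θ : Ω))
    -- The bound n ≤ p improves to equality: σ multiplies θ by some ζ of order p, so p divides n.
    -- Finiteness of the order excludes the default value n = 0.
    have hnp : n = p := by
      obtain ⟨ζ, hζ, hσζ⟩ := exists_apply_eq_mul hp hξ σ hθ
      have hθ0 : θ ≠ 0 := by rintro rfl; simp at hσθ
      have h1 := hfix n (pow_orderOf_eq_one _) θ hθmem
      rw [pow_apply_of_apply_eq_mul hσζ] at h1
      have h2 : algebraMap F (secondSecond p F Ω) ζ ^ n = 1 := by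
        apply mul_right_cancel₀ hθ0
        rw [one_mul]
        exact h1
      rw [← map_pow, ← map_one (algebraMap F (secondSecond p F Ω))] at h2
      have h3 : ζ ^ n = 1 := (algebraMap F (secondSecond p F Ω)).injective h2
      have hζ1 : ζ ≠ 1 := by rintro rfl; exact hσθ (by rw [hσζ, map_one, one_mul])
      have := Fact.mk hp
      have hord : orderOf ζ = p := orderOf_eq_prime hζ hζ1
      have hdvd : p ∣ n := hord ▸ orderOf_dvd_of_pow_eq_one h3
      exact le_antisymm hle (Nat.le_of_dvd hfin.orderOf_pos hdvd)
    obtain ⟨u, hu⟩ := hroots y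
    have humem : u ∈ second p F⟮(θ : Ω)⟯ :=
      mem_maxElem_of_pow_eq hp (hξ.map_of_injective (algebraMap F F⟮(θ : Ω)⟯).injective)
        (a := ⟨y, hy⟩) hu
    exact ⟨⟨u, second_le_secondSecond hp hE humem⟩, hu,
      hfix p (orderOf_dvd_iff_pow_eq_one.1 hnp.dvd) u humem⟩
  refine eq_two_and_isOrderingSet hp hξ σ (fun a => ?_) (exists_pow_eq_of_notMem_Phi hp hξ hσ)
    (fun a θ hθ hσθ => ?_) (fun h2 a θ hθ hσθ => ?_)
  · obtain ⟨x, hx⟩ := hroots (algebraMap F Ω a)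
    exact ⟨⟨x, third_le_secondSecond p (maxElem_le_third p (mem_maxElem_of_pow_eq hp hξ hx))⟩,
      Subtype.ext hx⟩
  · obtain ⟨u, hu, hσu⟩ := key a θ hθ hσθ θ (mem_adjoin_simple_self F _)
    exact ⟨u, Subtype.ext hu, hσu⟩
  · subst h2
    obtain ⟨u, hu, hσu⟩ := key a θ hθ hσθ (1 + θ)
      (add_mem (one_mem _) (mem_adjoin_simple_self F _))
    exact ⟨u, Subtype.ext hu, hσu⟩

end Third

end SmallGalois

namespace SmallGalois

open IntermediateField Polynomial

/-! ### Artin–Schreier theory inside an extension of exponent dividing 4 -/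

section FormallyReal

theorem IsSumSq.map_ringHom {A B : Type*} [Semiring A] [Semiring B] (f : A →+* B) {s : A}
    (hs : IsSumSq s) : IsSumSq (f s) := by
  induction hs with
  | zero => simp
  | sq_add a _ ih =>
    rw [map_add, map_mul]
    exact IsSumSq.sq_add _ ih

theorem isFormallyReal_of_isSemireal (K : Type*) [Field K] [IsSemireal K] :
    IsFormallyReal K := by
  refine IsFormallyReal.of_eq_zero_of_eq_zero_of_mul_self_add fun {s a} hs h => ?_
  by_contra ha
  refine IsSemireal.one_add_ne_zero (hs.mul (IsSumSq.mul_self a⁻¹)) ?_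
  field_simp
  linear_combination h

theorem isSemireal_of_isFormallyReal (K : Type*) [Field K] [IsFormallyReal K] :
    IsSemireal K where
  one_add_ne_zero hs h := one_ne_zero (IsFormallyReal.eq_zero_of_add_right IsSumSq.one hs h)

variable {F L : Type*} [Field F] [Field L] [Algebra F L]

/-- Elements of a quadratic extension `K(x)` are of the form `s + t x`. -/
theorem exists_eq_add_mul_of_mem_adjoin_sqrt {x y : L} {a : F} (hx : x ^ 2 = algebraMap F L a)
    (hy : y ∈ F⟮x⟯) : ∃ s t : F, y = algebraMap F L s + algebraMap F L t * x := by
  have hint : IsAlgebraic F x :=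
    IsIntegral.isAlgebraic ⟨X ^ 2 - C a, monic_X_pow_sub_C a two_ne_zero, by simp [hx]⟩
  rw [← mem_toSubalgebra, adjoin_simple_toSubalgebra_of_isAlgebraic hint] at hy
  induction hy using Algebra.adjoin_induction with
  | mem y hy =>
    rw [Set.mem_singleton_iff] at hy
    exact ⟨0, 1, by simp [hy]⟩
  | algebraMap r => exact ⟨r, 0, by simp⟩
  | add y z _ _ hy hz =>
    obtain ⟨s, t, rfl⟩ := hy
    obtain ⟨s', t', rfl⟩ := hz
    exact ⟨s + s', t + t', by simp only [map_add]; ring⟩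
  | mul y z _ _ hy hz =>
    obtain ⟨s, t, rfl⟩ := hy
    obtain ⟨s', t', rfl⟩ := hz
    refine ⟨s * s' + t * t' * a, s * t' + t * s', ?_⟩
    simp only [map_add, map_mul, ← hx]
    ring

/-- Sum the identities (c + dx)² = c² + a d² + 2cd·x; the coefficient r of x needs no control. -/
theorem exists_eq_of_isSumSq_adjoin_sqrt {x : L} {a : F} (hx : x ^ 2 = algebraMap F L a)
    {y : F⟮x⟯} (hy : IsSumSq y) : ∃ s t r : F, IsSumSq s ∧ IsSumSq t ∧
      (y : L) = algebraMap F L (s + a * t) + algebraMap F L r * x := by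
  induction hy with
  | zero => exact ⟨0, 0, 0, IsSumSq.zero, IsSumSq.zero, by simp⟩
  | @sq_add b y _ ih =>
    obtain ⟨s, t, r, hs, ht, h⟩ := ih
    obtain ⟨c, d, hb⟩ := exists_eq_add_mul_of_mem_adjoin_sqrt hx b.2
    refine ⟨c * c + s, d * d + t, 2 * c * d + r, IsSumSq.sq_add c hs, IsSumSq.sq_add d ht, ?_⟩
    rw [AddMemClass.coe_add, MulMemClass.coe_mul, h, hb]
    simp only [map_add, map_mul, map_ofNat, ← hx]
    ring

/-- Writing -1 as a sum of squares in F(x) and comparing coefficients gives -1 = s + at with s, t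
sums of squares and t ≠ 0; then -a = (1 + s)t/t². -/
theorem isSumSq_neg_of_not_isSemireal_adjoin_sqrt [IsSemireal F] {x : L} {a : F}
    (hx : x ^ 2 = algebraMap F L a) (hxF : x ∉ (algebraMap F L).range)
    (h : ¬ IsSemireal F⟮x⟯) : IsSumSq (-a) := by
  rw [isSemireal_iff_not_isSumSq_neg_one, not_not] at h
  obtain ⟨s, t, r, hs, ht, hst⟩ := exists_eq_of_isSumSq_adjoin_sqrt hx h
  have hr : r = 0 := by
    by_contra hr
    have hr' : algebraMap F L r ≠ 0 := (_root_.map_ne_zero _).2 hr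
    refine hxF ⟨(-1 - (s + a * t)) / r, ?_⟩
    rw [map_div₀, div_eq_iff hr', map_sub, map_neg, map_one]
    have : (-1 : L) = _ := hst
    linear_combination this
  have h1 : -1 = s + a * t := by
    apply (algebraMap F L).injective
    rw [hr, map_zero, zero_mul, add_zero] at hst
    rw [← hst]
    simp
  have ht0 : t ≠ 0 := by
    rintro rfl
    rw [mul_zero, add_zero] at h1
    exact IsSemireal.not_isSumSq_neg_one F (h1 ▸ hs)
  have h2 : -a = (1 + s) * t * (t⁻¹ * t⁻¹) := by
    field_simp
    linear_combination h1
  rw [h2]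
  exact ((IsSumSq.one.add hs).mul ht).mul (IsSumSq.mul_self _)

/-- Zorn's lemma applies because a sum of squares equal to -1 involves finitely many elements, so it
already occurs in one member of a chain. -/
theorem exists_maximal_isSemireal (F L : Type*) [Field F] [Field L] [Algebra F L]
    [IsSemireal F] : ∃ R : IntermediateField F L,
      Maximal (fun R : IntermediateField F L => IsSemireal R) R := by
  have hbot : IsSemireal (⊥ : IntermediateField F L) := by
    rw [isSemireal_iff_not_isSumSq_neg_one]
    intro h
    refine IsSemireal.not_isSumSq_neg_one F ?_
    simpa using IsSumSq.map_ringHom (botEquiv F L).toRingEquiv.toRingHom h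
  suffices h : ∀ c ⊆ {R : IntermediateField F L | IsSemireal R}, IsChain (· ≤ ·) c →
      ∀ R₀ ∈ c, IsSemireal (sSup c : IntermediateField F L) by
    obtain ⟨R, -, hR⟩ := zorn_le_nonempty₀ {R : IntermediateField F L | IsSemireal R}
      (fun c hc hchain R₀ hR₀ => ⟨sSup c, h c hc hchain R₀ hR₀, fun z hz => le_sSup hz⟩) ⊥ hbot
    exact ⟨R, hR⟩
  intro c hc hchain R₀ hR₀
  have hmem : ∀ x : L, x ∈ sSup c → ∃ R ∈ c, x ∈ R := by
    intro x hx
    have : Nonempty c := ⟨⟨R₀, hR₀⟩⟩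
    rw [sSup_eq_iSup', ← SetLike.mem_coe, coe_iSup_of_directed hchain.directed,
      Set.mem_iUnion] at hx
    obtain ⟨R, hR⟩ := hx
    exact ⟨R, R.2, hR⟩
  have key : ∀ s : (sSup c : IntermediateField F L), IsSumSq s →
      ∃ R ∈ c, ∃ t : R, IsSumSq t ∧ (t : L) = s := by
    intro s hs
    induction hs with
    | zero => exact ⟨R₀, hR₀, 0, IsSumSq.zero, rfl⟩
    | @sq_add b s _ ih =>
      obtain ⟨R₁, hR₁, t, ht, hts⟩ := ih
      obtain ⟨R₂, hR₂, hb⟩ := hmem b b.2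
      obtain ⟨R, hR, h₁, h₂⟩ : ∃ R ∈ c, R₁ ≤ R ∧ R₂ ≤ R := by
        rcases hchain.total hR₁ hR₂ with h | h
        · exact ⟨R₂, hR₂, h, le_rfl⟩
        · exact ⟨R₁, hR₁, le_rfl, h⟩
      refine ⟨R, hR, ⟨b, h₂ hb⟩ * ⟨b, h₂ hb⟩ + inclusion h₁ t, IsSumSq.sq_add _
        (IsSumSq.map_ringHom (inclusion h₁).toRingHom ht), ?_⟩
      rw [AddMemClass.coe_add, AddMemClass.coe_add, coe_inclusion, hts]
      rfl
  rw [isSemireal_iff_not_isSumSq_neg_one]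
  intro h
  obtain ⟨R, hR, t, ht, hts⟩ := key _ h
  have : IsSemireal R := hc hR
  have h1 : t = -1 := Subtype.ext (by rw [hts]; simp)
  exact IsSemireal.not_isSumSq_neg_one R (h1 ▸ ht)

/-- If neither x nor ix were in R, adjoining either would destroy semireality by maximality. Then
-x² and x² would both be sums of squares in R, forcing x = 0. -/
theorem mem_or_mul_mem_of_maximal {R : IntermediateField F L}
    (hR : Maximal (fun R : IntermediateField F L => IsSemireal R) R) {i x : L}
    (hi : i ^ 2 = -1) (hx : x ^ 2 ∈ R) : x ∈ R ∨ i * x ∈ R := by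
  have : IsSemireal R := hR.prop
  have := isFormallyReal_of_isSemireal R
  have key : ∀ (y : L) (a : R), y ^ 2 = algebraMap R L a → y ∉ R → IsSumSq (-a) := by
    intro y a hy hyR
    refine isSumSq_neg_of_not_isSemireal_adjoin_sqrt hy (by rintro ⟨c, rfl⟩; exact hyR c.2) ?_
    intro h
    refine hyR (hR.le_of_ge (y := R⟮y⟯.restrictScalars F) h ?_ ?_)
    · intro z hz
      exact IntermediateField.algebraMap_mem R⟮y⟯ ⟨z, hz⟩
    · exact mem_adjoin_simple_self R y
  by_contra! hcon
  have h1 := key x ⟨x ^ 2, hx⟩ rfl hcon.1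
  have h2 := key (i * x) (-⟨x ^ 2, hx⟩) (by rw [mul_pow, hi, map_neg, neg_one_mul]; rfl) hcon.2
  have h3 := congrArg Subtype.val (IsFormallyReal.eq_zero_of_isSumSq_of_neg_isSumSq h1 h2)
  have h4 : x = 0 := by simpa using h3
  exact hcon.1 (h4 ▸ zero_mem R)

/-- A nontrivial Galois extension whose group has exponent dividing `4` contains a nontrivial
square root. -/
theorem exists_sq_mem_of_pow_four_eq_one [IsGalois F L] (h2 : (2 : F) ≠ 0)
    (hexp : ∀ σ : Gal(L/F), σ ^ 4 = 1) {z : L} (hz : z ∉ (algebraMap F L).range) :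
    ∃ y : L, y ∉ (algebraMap F L).range ∧ y ^ 2 ∈ (algebraMap F L).range := by
  let M : IntermediateField F L := normalClosure F F⟮z⟯ L
  have : FiniteDimensional F F⟮z⟯ :=
    adjoin.finiteDimensional (Algebra.IsIntegral.isIntegral z)
  have : FiniteDimensional F M := normalClosure.is_finiteDimensional F F⟮z⟯ L
  have : IsGalois F M := IsGalois.normalClosure F F⟮z⟯ L
  have hzM : z ∈ M := le_normalClosure F⟮z⟯ (mem_adjoin_simple_self F z)
  have := Fact.mk Nat.prime_two
  have hpg : IsPGroup 2 Gal(M/F) := by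
    intro g
    obtain ⟨σ, rfl⟩ := AlgEquiv.restrictNormalHom_surjective (F := F) (K₁ := M) L g
    exact ⟨2, by rw [← map_pow, show 2 ^ 2 = 4 from rfl, hexp, map_one]⟩
  obtain ⟨n, hn⟩ := hpg.exists_card_eq
  have hn0 : n ≠ 0 := by
    rintro rfl
    rw [pow_zero, IsGalois.card_aut_eq_finrank, IntermediateField.finrank_eq_one_iff] at hn
    rw [hn] at hzM
    exact hz (mem_bot.1 hzM)
  obtain ⟨m, rfl⟩ := Nat.exists_eq_succ_of_ne_zero hn0
  -- H has index 2, so its fixed field is quadratic over F and, as -1 ≠ 1, generated by a square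
  -- root.
  obtain ⟨H, hH⟩ := Sylow.exists_subgroup_card_pow_prime (G := Gal(M/F)) 2 (n := m)
    (by rw [hn]; exact pow_dvd_pow 2 m.le_succ)
  let K := fixedField H
  have hK2 : Module.finrank F K = 2 := by
    have h1 := Module.finrank_mul_finrank F K M
    rw [finrank_fixedField_eq_card, hH, ← IsGalois.card_aut_eq_finrank F M, hn, pow_succ'] at h1
    exact Nat.eq_of_mul_eq_mul_right (by positivity) h1
  have : Algebra.IsQuadraticExtension F K := ⟨hK2⟩
  have : Algebra.IsSeparable F K := Algebra.isSeparable_tower_bot_of_isSeparable F K M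
  obtain ⟨y, ⟨b, hb⟩, hy⟩ := exists_root_adjoin_eq_top_of_isCyclic F K (by
    rw [hK2]
    refine ⟨-1, (mem_primitiveRoots two_pos).2 (IsPrimitiveRoot.mk_of_lt _ two_pos (by simp) ?_)⟩
    intro l hl hl' h
    obtain rfl : l = 1 := by lia
    exact h2 (by linear_combination -h))
  rw [hK2] at hb
  refine ⟨((y : M) : L), ?_, b, ?_⟩
  · rintro ⟨c, hc⟩
    have hyc : y = algebraMap F K c := Subtype.ext (Subtype.ext hc.symm)
    have : F⟮y⟯ = ⊥ := by
      rw [adjoin_simple_eq_bot_iff, hyc]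
      exact IntermediateField.algebraMap_mem _ c
    rw [this] at hy
    have h3 := finrank_top' (F := F) (E := K)
    rw [← hy, hK2, IntermediateField.finrank_bot] at h3
    exact absurd h3 (by decide)
  · exact congrArg (fun t : K => ((t : M) : L)) hb

/-- A formally real field has an involution of every Galois extension with group of exponent
dividing `4` which moves a given square root of `-1`. -/
theorem exists_involution [IsGalois F L] [IsFormallyReal F] (hexp : ∀ σ : Gal(L/F), σ ^ 4 = 1)
    {i : L} (hi : i ^ 2 = -1) : ∃ σ : Gal(L/F), σ ^ 2 = 1 ∧ σ i = -i := by
  have := isSemireal_of_isFormallyReal F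
  obtain ⟨R, hR⟩ := exists_maximal_isSemireal F L
  have : IsSemireal R := hR.prop
  have := isFormallyReal_of_isSemireal R
  have hi' : i ^ 2 = algebraMap R L (-1) := by rw [hi, map_neg, map_one]
  have hmem : ∀ (x : L) (a : R), x ^ 2 = algebraMap R L a →
      (∃ b : R, x = algebraMap R L b) ∨ ∃ b : R, i * x = algebraMap R L b := by
    intro x a hx
    rcases mem_or_mul_mem_of_maximal hR hi (x := x) (by rw [hx]; exact a.2) with h | h
    · exact Or.inl ⟨⟨_, h⟩, rfl⟩
    · exact Or.inr ⟨⟨_, h⟩, rfl⟩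
  -- Such a c exists because i is not in R. That c² = 1 is known only once L = R(i).
  obtain ⟨c, hc⟩ : ∃ c : Gal(L/R), c i = -i := by
    by_contra! hcon
    have h1 : i ∈ Set.range (algebraMap R L) := by
      rw [InfiniteGalois.mem_range_algebraMap_iff_fixed]
      intro f
      have h2 : f i ^ 2 = i ^ 2 := by rw [← map_pow, hi', AlgEquiv.commutes]
      exact (sq_eq_sq_iff_eq_or_eq_neg.1 h2).resolve_right (hcon f)
    obtain ⟨b, rfl⟩ := h1
    refine IsSemireal.not_isSumSq_neg_one R ?_
    have h3 : b * b = -1 := by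
      apply (algebraMap R L).injective
      rw [map_mul, ← sq, hi']
    exact h3 ▸ IsSumSq.mul_self b
  have h2L : (2 : L) ≠ 0 := by
    have : (2 : R) ≠ 0 := two_ne_zero
    rw [← map_ofNat (algebraMap R L) 2]
    exact (_root_.map_ne_zero _).2 this
  have hadj : ∀ x : L, ((∃ b : R, x = algebraMap R L b) ∨ ∃ b : R, i * x = algebraMap R L b) →
      x ∈ R⟮i⟯ := by
    have hiC := mem_adjoin_simple_self R i
    rintro x (⟨b, rfl⟩ | ⟨b, hb⟩)
    · exact IntermediateField.algebraMap_mem _ b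
    · have : x = -(i * algebraMap R L b) := by rw [← hb]; linear_combination x * hi
      rw [this]
      exact neg_mem (mul_mem hiC (IntermediateField.algebraMap_mem _ b))
  have htop : ∀ z : L, z ∈ R⟮i⟯ := by
    by_contra! hz
    obtain ⟨z, hz⟩ := hz
    obtain ⟨y, hy, b, hb⟩ := exists_sq_mem_of_pow_four_eq_one (F := R⟮i⟯) (L := L) (z := z)
      (by
        intro h
        apply h2L
        simpa using congrArg (algebraMap R⟮i⟯ L) h)
      (by
        intro σ
        ext x
        have := congrArg (fun f : Gal(L/F) => f x)
          (hexp (AlgEquiv.restrictScalarsHom F (AlgEquiv.restrictScalarsHom R σ)))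
        rw [← map_pow, ← map_pow] at this
        exact this)
      (by rintro ⟨w, rfl⟩; exact hz w.2)
    have hyC : y ∉ R⟮i⟯ := fun h => hy ⟨⟨y, h⟩, rfl⟩
    obtain ⟨s, t, hst⟩ := exists_eq_add_mul_of_mem_adjoin_sqrt hi' b.2
    have hys : y ^ 2 = algebraMap R L s + algebraMap R L t * i := by rw [← hb]; exact hst
    have hcys : (c y) ^ 2 = algebraMap R L s - algebraMap R L t * i := by
      rw [← map_pow, hys, map_add, map_mul, hc, AlgEquiv.commutes, AlgEquiv.commutes]
      ring
    have hn2 : (y * c y) ^ 2 = algebraMap R L (s * s + t * t) := by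
      rw [mul_pow, hys, hcys, map_add, map_mul, map_mul]
      linear_combination - algebraMap R L t ^ 2 * hi
    -- The square of y·cy is the norm s² + t² of y². If i·y·cy were some r in R, then r² + s² + t² =
    -- 0 would force y = 0.
    obtain ⟨n, hn⟩ : ∃ n : R, y * c y = algebraMap R L n := by
      refine (hmem _ _ hn2).resolve_right ?_
      rintro ⟨r, hr⟩
      have h0 : r * r + (s * s + t * t) = 0 := by
        apply (algebraMap R L).injective
        rw [map_add, ← hn2, map_mul, ← hr, map_zero]
        linear_combination (y * c y) ^ 2 * hi
      have h1 := IsFormallyReal.eq_zero_of_add_right (IsSumSq.mul_self r)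
        ((IsSumSq.mul_self s).add (IsSumSq.mul_self t)) h0
      have hyc : y * c y = 0 := by
        have : (y * c y) ^ 2 = 0 := by
          rw [hn2, show s * s + t * t = 0 by linear_combination h0 - h1, map_zero]
        exact pow_eq_zero_iff two_ne_zero |>.1 this
      have hy0 : y = 0 := by
        rcases mul_eq_zero.1 hyc with h | h
        · exact h
        · exact (map_eq_zero_iff c c.injective).1 h
      exact hyC (hy0 ▸ zero_mem _)
    -- (y ± cy)² = 2s ± 2n lies in R, so both y + cy and y - cy lie in R(i), and hence so does y.
    have hp := hadj _ (hmem (y + c y) (2 * s + 2 * n) (by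
      simp only [map_add, map_mul, map_ofNat]
      linear_combination hys + hcys + 2 * hn))
    have hm := hadj _ (hmem (y - c y) (2 * s - 2 * n) (by
      simp only [map_sub, map_mul, map_ofNat]
      linear_combination hys + hcys - 2 * hn))
    apply hyC
    have h2C : (2 : L) ∈ R⟮i⟯ := ofNat_mem _ 2
    have : y = ((y + c y) + (y - c y)) * 2⁻¹ := by
      field_simp
      ring
    rw [this]
    exact mul_mem (add_mem hp hm) (inv_mem h2C)
  refine ⟨AlgEquiv.restrictScalarsHom F c, ?_, hc⟩
  ext z
  obtain ⟨s, t, rfl⟩ := exists_eq_add_mul_of_mem_adjoin_sqrt hi' (htop z)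
  change c (c _) = _
  simp only [map_add, map_mul, AlgEquiv.commutes, hc, map_neg, neg_neg]
  rfl

end FormallyReal

end SmallGalois

namespace SmallGalois

open IntermediateField

/-! ### Exponent of V_F and involutions outside the Frattini subgroup -/

section Involutions

variable {F Ω : Type*} [Field F] [Field Ω] [Algebra F Ω] [IsGalois F Ω]

theorem pow_sq_eq_one_of_secondSecond {p : ℕ} (hp : p.Prime) (σ : VGroup p F Ω) :
    σ ^ (p * p) = 1 := by
  have := isGalois_secondSecond (F := F) (Ω := Ω) hp
  obtain ⟨τ, rfl⟩ :=
    AlgEquiv.restrictNormalHom_surjective (F := F) (K₁ := secondSecond p F Ω) Ω σ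
  rw [← map_pow, ← MonoidHom.mem_ker, restrictNormalHom_ker,
    IntermediateField.mem_fixingSubgroup_iff]
  intro x hx
  -- τ^p fixes F^(2), so it may be regarded as an automorphism over F^(2), whose p-th power fixes
  -- (F^(2))^(2).
  let g : Gal(Ω/maxElem p F Ω) := AlgEquiv.ofRingEquiv (f := (τ ^ p).toRingEquiv)
    fun c => ((mem_maxElem_iff hp (c : Ω)).1 c.2 τ 1).1
  have hg : ∀ (n : ℕ) (z : Ω), (g ^ n) z = ((τ ^ p) ^ n) z := by
    intro n
    induction n with
    | zero => intro z; rfl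
    | succ n ih =>
      intro z
      rw [pow_succ, pow_succ, AlgEquiv.mul_apply, AlgEquiv.mul_apply, ih]
      rfl
  rw [pow_mul, ← hg]
  exact ((mem_maxElem_iff hp x).1 hx g 1).1

theorem notMem_Phi_and_orderOf_eq_two {L : Type*} [Field L] [Algebra F L] [IsGalois F L] {ξ : F}
    (hξ : IsPrimitiveRoot ξ 2) {σ : Gal(L/F)} (hσ : σ ^ 2 = 1) {i : L} (hi : i ^ 2 = -1)
    (hσi : σ i = -i) : σ ∉ Phi 2 Gal(L/F) ∧ orderOf σ = 2 := by
  have h2 : (2 : L) ≠ 0 := by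
    have := (hξ.map_of_injective (algebraMap F L).injective).neZero'
    exact_mod_cast this.out
  have hne : σ i ≠ i := by
    intro h
    have h3 : 2 * i = 0 := by linear_combination hσi - h
    rcases mul_eq_zero.1 h3 with h3 | rfl
    · exact h2 h3
    · simp at hi
  refine ⟨notMem_Phi_of_apply_ne (a := -1) Nat.prime_two hξ
    (by rw [hi, map_neg, map_one]) hne, ?_⟩
  have := Fact.mk Nat.prime_two
  refine orderOf_eq_prime hσ ?_
  rintro rfl
  exact hne rfl

end Involutions

end SmallGalois

/-! ### The main theorem -/

open SmallGalois in
theorem mainTheorem5 (p : ℕ) (hp : p.Prime) (F Ω : Type*) [Field F] [Field Ω] [Algebra F Ω]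
    [IsSepClosure F Ω] (ξ : F) (hξ : IsPrimitiveRoot ξ p) :
    List.TFAE
      [∃ σ : SmallGalois.VGroup p F Ω,
          σ ∉ SmallGalois.Phi p (SmallGalois.VGroup p F Ω) ∧ orderOf σ = p,
        ∃ σ : SmallGalois.WGroup p F Ω,
          σ ∉ SmallGalois.Phi p (SmallGalois.WGroup p F Ω) ∧ orderOf σ = p,
        ∃ σ : SmallGalois.VGroup p F Ω,
          σ ∉ SmallGalois.Phi p (SmallGalois.VGroup p F Ω) ∧
          ∀ (E : IntermediateField F Ω) (hE : SmallGalois.IsCyclicExt p F E),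
            IsOfFinOrder (SmallGalois.toT hp E hE σ) ∧
              orderOf (SmallGalois.toT hp E hE σ) ≤ p,
        p = 2 ∧ IsFormallyReal F] ∧
    (∀ σ : SmallGalois.VGroup p F Ω,
        σ ∉ SmallGalois.Phi p (SmallGalois.VGroup p F Ω) → orderOf σ = p →
        SmallGalois.IsOrderingSet (SmallGalois.fixedRoots σ)) ∧
    (∀ σ : SmallGalois.WGroup p F Ω,
        σ ∉ SmallGalois.Phi p (SmallGalois.WGroup p F Ω) → orderOf σ = p →
        SmallGalois.IsOrderingSet (SmallGalois.fixedRoots σ)) ∧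
    (∀ σ : SmallGalois.VGroup p F Ω,
        σ ∉ SmallGalois.Phi p (SmallGalois.VGroup p F Ω) →
        (∀ (E : IntermediateField F Ω) (hE : SmallGalois.IsCyclicExt p F E),
            IsOfFinOrder (SmallGalois.toT hp E hE σ) ∧
              orderOf (SmallGalois.toT hp E hE σ) ≤ p) →
        SmallGalois.IsOrderingSet (SmallGalois.fixedRoots σ)) := by
  have hgal : IsGalois F Ω := IsSepClosure.isGalois
  have hsep : IsSepClosed Ω := IsSepClosure.sep_closed F
  -- A primitive p-th root of unity makes p nonzero in Ω, so the separably closed field Ω contains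
  -- all p-th roots.
  have hroots : ∀ y : Ω, ∃ x : Ω, x ^ p = y := fun y =>
    have := NeZero.mk hp.ne_zero
    have := (hξ.map_of_injective (algebraMap F Ω).injective).neZero'
    IsSepClosed.exists_pow_nat_eq y p
  have hV : ∀ σ : VGroup p F Ω, orderOf σ = p → ∀ (E : IntermediateField F Ω)
      (hE : IsCyclicExt p F E),
      IsOfFinOrder (toT hp E hE σ) ∧ orderOf (toT hp E hE σ) ≤ p := by
    intro σ hord E hE
    have h1 : toT hp E hE σ ^ p = 1 := by
      rw [← map_pow, orderOf_dvd_iff_pow_eq_one.1 hord.dvd, map_one]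
    exact ⟨isOfFinOrder_iff_pow_eq_one.2 ⟨p, hp.pos, h1⟩,
      orderOf_le_of_pow_eq_one hp.pos h1⟩
  refine ⟨?_, fun σ hσ hord => (eq_two_and_isOrderingSet_of_toT hp hξ hroots hσ (hV σ hord)).2,
    fun σ hσ hord => (eq_two_and_isOrderingSet_of_third hp hξ hroots hσ hord).2,
    fun σ hσ hT => (eq_two_and_isOrderingSet_of_toT hp hξ hroots hσ hT).2⟩
  have hinv : p = 2 ∧ IsFormallyReal F →
      (∃ σ : VGroup p F Ω, σ ∉ Phi p (VGroup p F Ω) ∧ orderOf σ = p) ∧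
      ∃ σ : WGroup p F Ω, σ ∉ Phi p (WGroup p F Ω) ∧ orderOf σ = p := by
    rintro ⟨rfl, hF⟩
    have hGV := isGalois_secondSecond (F := F) (Ω := Ω) hp
    have hGW := isGalois_third (F := F) (Ω := Ω) 2
    obtain ⟨i, hi⟩ := hroots (-1)
    have hiW : i ∈ third 2 F Ω := maxElem_le_third 2
      (mem_maxElem_of_pow_eq (a := -1) hp hξ (by rw [hi, map_neg, map_one]))
    have hiV : i ∈ secondSecond 2 F Ω := third_le_secondSecond 2 hiW
    obtain ⟨σ, hσ, hσi⟩ := exists_involution (F := F) (L := secondSecond 2 F Ω)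
      (pow_sq_eq_one_of_secondSecond hp) (i := ⟨i, hiV⟩) (Subtype.ext hi)
    -- Since i lies in F^(2) ⊆ F^(3), the restriction of σ to F^(3) still moves i, so it remains of
    -- order 2 and outside the Frattini subgroup.
    refine ⟨⟨σ, notMem_Phi_and_orderOf_eq_two hξ hσ (Subtype.ext hi) hσi⟩,
      restrictHom (third_le_secondSecond 2) σ,
      notMem_Phi_and_orderOf_eq_two hξ (i := ⟨i, hiW⟩) ?_ (Subtype.ext hi) ?_⟩
    · rw [← map_pow, hσ, map_one]
    · apply Subtype.ext
      rw [coe_restrictHom]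
      exact congrArg Subtype.val hσi
  tfae_have 1 → 3 := fun ⟨σ, hσ, hord⟩ => ⟨σ, hσ, hV σ hord⟩
  tfae_have 3 → 4 := fun ⟨σ, hσ, hT⟩ =>
    have h := eq_two_and_isOrderingSet_of_toT hp hξ hroots hσ hT
    ⟨h.1, h.2.isFormallyReal⟩
  tfae_have 2 → 4 := fun ⟨σ, hσ, hord⟩ =>
    have h := eq_two_and_isOrderingSet_of_third hp hξ hroots hσ hord
    ⟨h.1, h.2.isFormallyReal⟩
  tfae_have 4 → 1 := fun h => (hinv h).1
  tfae_have 4 → 2 := fun h => (hinv h).2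
  tfae_finish
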